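/- The entanglement game with $k$ cops on a finite graph $G$ is played as follows. First the robber chooses a starting vertex, while all $k$ cops are outside the graph. In every turn the cops either all stay where they are, or one of them flies to the current vertex of the robber; afterwards the robber has to move to a neighbour of his current vertex that is not occupied by a cop. If there is no such neighbour, the cops win; the robber wins if he runs away indefinitely. We say that $k$ cops suffice on $G$ if they have a strategy that wins against every behaviour of the robber. There is a constant $\alpha>0$ with the following property. For even $n$, let $H$ be a Hamiltonian cycle on the vertex set $\{0,\dots,n-1\}$, let $M$ be a uniformly random perfect matching of the complete graph on the same vertex set, and let $G=H\cup M$. Then with high probability $\alpha n$ cops do not suffice to catch the robber on $G$. That is, for every $\varepsilon>0$ there is an $N$ such that for all even $n\ge N$ and every Hamiltonian cycle $H$ on $\{0,\dots,n-1\}$, $$\mathbb{P}_M\bigl(\text{for every integer } 0\le k\le \alpha n,\ k \text{ cops do not suffice on } H\cup M\bigr)\ \ge\ 1-\varepsilon .$$ -/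

import Mathlib

/-! The entanglement game with `k` cops on an undirected graph, and the union of a Hamiltonian
cycle with a perfect matching. -/

namespace Entanglement

variable {V : Type*} {k : ℕ}

/-- A (deterministic, perfect-recall) strategy for `k` cops. Its argument is the list of all
positions of the robber so far, from the starting position up to the current one. The value `none`
means that all cops stay, the value `some i` that cop `i` flies to the current position of the
robber. (The positions of the cops are determined by the strategy and this list.) -/
abbrev CopStrategy (V : Type*) (k : ℕ) : Type _ := List V → Option (Fin k)

/-- The positions of the robber in turns `0, …, t`. -/
def history (r : ℕ → V) (t : ℕ) : List V := (List.range (t + 1)).map r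

/-- The positions of the cops (`none` = outside the graph) at the beginning of turn `t`, when the
cops follow the strategy `σ` and the robber is at `r s` at the beginning of turn `s`. Initially all
cops are outside the graph. -/
def copPositions (σ : CopStrategy V k) (r : ℕ → V) : ℕ → Fin k → Option V
  | 0 => fun _ => none
  | t + 1 =>
    match σ (history r t) with
    | none => copPositions σ r t
    | some i => Function.update (copPositions σ r t) i (some (r t))

/-- The robber runs away indefinitely along `r` from cops who follow `σ`: in every turn, after the
action of the cops, he moves to a neighbour of his position that is not occupied by a cop. -/
def RunsAway (G : SimpleGraph V) (σ : CopStrategy V k) (r : ℕ → V) : Prop :=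
  ∀ t : ℕ, G.Adj (r t) (r (t + 1)) ∧ ∀ i : Fin k, copPositions σ r (t + 1) i ≠ some (r (t + 1))

/-- `k` cops suffice to catch the robber on `G`: they have a strategy against which the robber
cannot run away indefinitely, whatever he does (so that every play consistent with the strategy
reaches a turn in which the robber has no legal move). -/
def CopsSuffice (G : SimpleGraph V) (k : ℕ) : Prop :=
  ∃ σ : CopStrategy V k, ∀ r : ℕ → V, ¬ RunsAway G σ r

/-- The set of perfect matchings of the complete graph on `V`. -/
def perfectMatchings (V : Type*) : Set (⊤ : SimpleGraph V).Subgraph :=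
  {M | M.IsPerfectMatching}

/-- All sets of subgraphs are measurable. -/
instance subgraphMeasurableSpace (G : SimpleGraph V) : MeasurableSpace G.Subgraph := ⊤

/-- The law of a uniformly random perfect matching on the vertex set `V`. -/
noncomputable def randomPerfectMatching (V : Type*) :
    MeasureTheory.Measure (⊤ : SimpleGraph V).Subgraph :=
  ProbabilityTheory.uniformOn (perfectMatchings V)

/-- The graph `H ∪ M` on the vertex set `V`, where `H` consists of the edges of the closed
walk `c`. -/
def cycleUnionMatching {a : V} (c : (⊤ : SimpleGraph V).Walk a a)
    (M : (⊤ : SimpleGraph V).Subgraph) : SimpleGraph V :=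
  c.toSubgraph.spanningCoe ⊔ M.spanningCoe

end Entanglement

/-! The robber survives whenever deleting any `k` vertices leaves a component with at least `n/2 +
1` vertices. Such components before and after a cop's flight share two vertices, hence one other
than the robber's position `v`, and a walk towards it shows a safe neighbour of `v`
(`InGiant.exists_adj`).

Such a component can be missing for some small `C` only if some set `A` with `n/6 ≤ |A| ≤ 5n/6` is
closed under the matching and has few switches along the cycle (`exists_inGiant`). A union bound
excludes this: there are at most about `2 ^ (0.044 n)` sets with few switches, and each is closed
under a random matching with probability at most `2 ^ (-⌊n/12⌋)` (`card_pairingsPreserving_mul_le`,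
`card_badPairings_mul_le`). -/

namespace Entanglement

open Finset

/-! ### The robber's strategy: staying in the giant component. -/

section Robber

variable {V : Type*} {k : ℕ}

/-- Reachability in the graph obtained from `G` by deleting the vertices in `C`. -/
def ReachAvoiding (G : SimpleGraph V) (C : Finset V) : V → V → Prop :=
  Relation.ReflTransGen fun x y => G.Adj x y ∧ x ∉ C ∧ y ∉ C

theorem ReachAvoiding.symm {G : SimpleGraph V} {C : Finset V} {x y : V}
    (h : ReachAvoiding G C x y) : ReachAvoiding G C y x := by
  induction h with
  | refl => exact Relation.ReflTransGen.refl
  | tail _ h ih => exact ih.head ⟨h.1.symm, h.2.2, h.2.1⟩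

theorem ReachAvoiding.notMem {G : SimpleGraph V} {C : Finset V} {x y : V}
    (h : ReachAvoiding G C x y) (hx : x ∉ C) : y ∉ C := by
  induction h with
  | refl => exact hx
  | tail _ h _ => exact h.2.2

/-- A walk that avoids `C` and leaves `v` for good can be shortened to avoid `v` after its first
step. -/
theorem ReachAvoiding.exists_first_step {G : SimpleGraph V} {C C' : Finset V} {v z : V}
    (hC : ∀ x ∈ C', x ∈ C ∨ x = v) (h : ReachAvoiding G C v z) (hz : z ≠ v) :
    ∃ u, G.Adj v u ∧ u ∉ C' ∧ ReachAvoiding G C' u z := by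
  induction h with
  | refl => exact absurd rfl hz
  | @tail y z hy hyz ih =>
    have hz' : z ∉ C' := fun h => (hC z h).elim hyz.2.2 hz
    -- The walk may return to `v`; only the part after its last visit there is kept.
    by_cases hyv : y = v
    · subst hyv
      exact ⟨z, hyz.1, hz', Relation.ReflTransGen.refl⟩
    · obtain ⟨u, h1, h2, h3⟩ := ih hyv
      exact ⟨u, h1, h2, h3.tail ⟨hyz.1, h3.notMem h2, hz'⟩⟩

variable [Fintype V]

open Classical in
/-- The component of `v` in the graph obtained from `G` by deleting the vertices in `C`. -/
noncomputable def cluster (G : SimpleGraph V) (C : Finset V) (v : V) : Finset V :=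
  univ.filter fun w => ReachAvoiding G C v w

theorem mem_cluster {G : SimpleGraph V} {C : Finset V} {v w : V} :
    w ∈ cluster G C v ↔ ReachAvoiding G C v w := by
  simp [cluster]

/-- The component of `v` after deletion of `C` contains more than half of the vertices. -/
def InGiant (G : SimpleGraph V) (C : Finset V) (v : V) : Prop :=
  v ∉ C ∧ Fintype.card V + 2 ≤ 2 * (cluster G C v).card

/-- The robber's move: the old and new giant components overlap, and the only newly occupied vertex
can be `v`, which the robber is leaving. -/
theorem InGiant.exists_adj {G : SimpleGraph V} {C C' : Finset V} {v w : V}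
    (hv : InGiant G C v) (hw : InGiant G C' w) (hC : ∀ x ∈ C', x ∈ C ∨ x = v) :
    ∃ u, G.Adj v u ∧ InGiant G C' u := by
  classical
  -- The `+ 2` in `InGiant` yields two common vertices; one of them may be `v`.
  have hcard : 1 < (cluster G C v ∩ cluster G C' w).card := by
    have h1 := card_union_add_card_inter (cluster G C v) (cluster G C' w)
    have h2 : (cluster G C v ∪ cluster G C' w).card ≤ Fintype.card V := card_le_univ _
    have := hv.2
    have := hw.2
    omega
  obtain ⟨z, hz, hzv⟩ := exists_mem_ne hcard v
  rw [mem_inter, mem_cluster, mem_cluster] at hz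
  obtain ⟨u, h1, h2, h3⟩ := hz.1.exists_first_step hC hzv
  refine ⟨u, h1, h2, ?_⟩
  have : cluster G C' w ⊆ cluster G C' u := fun y hy =>
    mem_cluster.2 ((h3.trans hz.2.symm).trans (mem_cluster.1 hy))
  exact hw.2.trans (Nat.mul_le_mul_left 2 (card_le_card this))

open Classical in
/-- The vertices occupied by cops. -/
noncomputable def occupied (p : Fin k → Option V) : Finset V :=
  univ.filter fun x => ∃ i, p i = some x

theorem mem_occupied {p : Fin k → Option V} {x : V} : x ∈ occupied p ↔ ∃ i, p i = some x := by
  simp [occupied]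

theorem card_occupied_le (p : Fin k → Option V) : (occupied p).card ≤ k := by
  classical
  have : (occupied p).map ⟨some, Option.some_injective V⟩ ⊆ univ.image p := by
    intro y hy
    obtain ⟨x, hx, rfl⟩ := mem_map.1 hy
    obtain ⟨i, hi⟩ := mem_occupied.1 hx
    exact mem_image.2 ⟨i, mem_univ _, hi⟩
  calc (occupied p).card = _ := (card_map _).symm
    _ ≤ (univ.image p).card := card_le_card this
    _ ≤ (univ : Finset (Fin k)).card := card_image_le
    _ = k := by simp

/-- The positions of the cops after their action `a`, when the robber is at `v`. -/
def moveCops (p : Fin k → Option V) (v : V) : Option (Fin k) → Fin k → Option V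
  | none => p
  | some i => Function.update p i (some v)

theorem mem_occupied_moveCops {p : Fin k → Option V} {v x : V} {a : Option (Fin k)}
    (h : x ∈ occupied (moveCops p v a)) : x ∈ occupied p ∨ x = v := by
  obtain ⟨i, hi⟩ := mem_occupied.1 h
  cases a with
  | none => exact Or.inl (mem_occupied.2 ⟨i, hi⟩)
  | some j =>
    by_cases hij : i = j
    · subst hij
      right
      simpa [moveCops, eq_comm] using hi
    · left
      exact mem_occupied.2 ⟨i, by simpa [moveCops, Function.update_of_ne hij] using hi⟩

/-- If deleting any `k` vertices leaves a component with more than half of all vertices, then `k`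
cops do not suffice: the robber never leaves that component. -/
theorem not_copsSuffice_of_giant {G : SimpleGraph V}
    (hG : ∀ C : Finset V, C.card ≤ k → ∃ w, InGiant G C w) : ¬ CopsSuffice G k := by
  rintro ⟨σ, hσ⟩
  -- A state carries the history, which `σ` consults, and the positions together with the invariant,
  -- so that the play can be defined by recursion.
  have step : ∀ s : List V × {q : (Fin k → Option V) × V // InGiant G (occupied q.1) q.2},
      ∃ u, G.Adj s.2.1.2 u ∧ InGiant G (occupied (moveCops s.2.1.1 s.2.1.2 (σ s.1))) u := by
    rintro ⟨l, ⟨p, v⟩, h⟩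
    obtain ⟨w, hw⟩ := hG (occupied (moveCops p v (σ l))) (card_occupied_le _)
    exact h.exists_adj hw fun x hx => mem_occupied_moveCops hx
  choose next hadj hgiant using step
  obtain ⟨w, hw⟩ := hG (occupied (fun _ : Fin k => (none : Option V))) (card_occupied_le _)
  let S : ℕ → List V × {q : (Fin k → Option V) × V // InGiant G (occupied q.1) q.2} :=
    fun t => Nat.rec ([w], ⟨(fun _ => none, w), hw⟩)
      (fun _ s => (s.1 ++ [next s], ⟨(moveCops s.2.1.1 s.2.1.2 (σ s.1), next s), hgiant s⟩)) t
  let r : ℕ → V := fun t => (S t).2.1.2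
  have hh : ∀ t, history r t = (S t).1 := by
    intro t
    induction t with
    | zero => rfl
    | succ t ih =>
      have : history r (t + 1) = history r t ++ [r (t + 1)] := by
        simp [history, List.range_succ]
      rw [this, ih]
  have hp : ∀ t, copPositions σ r t = (S t).2.1.1 := by
    intro t
    induction t with
    | zero => rfl
    | succ t ih =>
      have : copPositions σ r (t + 1) = moveCops (copPositions σ r t) (r t) (σ (history r t)) := by
        cases h : σ (history r t) <;> simp only [copPositions, moveCops, h]
      rw [this, ih, hh]
  refine hσ r fun t => ⟨hadj (S t), fun i hi => ?_⟩
  rw [hp] at hi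
  exact (S (t + 1)).2.2.1 (mem_occupied.2 ⟨i, hi⟩)

end Robber

/-! ### From small vertex cuts to matching-closed sets with few switches. -/

section Separators

variable {V : Type*} [DecidableEq V]

/-- The indices `i < n` at which the sequence `g` enters or leaves the set `A`. -/
def switches (g : ℕ → V) (n : ℕ) (A : Finset V) : Finset ℕ :=
  (range n).filter fun i => ¬(g i ∈ A ↔ g (i + 1) ∈ A)

/-- If every switch of `A` along `g` involves a vertex of `C`, there are at most `2 |C|` of them. -/
theorem card_switches_le {g : ℕ → V} {n : ℕ} {A C : Finset V}
    (hg : Set.InjOn g (range n)) (hg' : Set.InjOn (fun i => g (i + 1)) (range n))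
    (h : ∀ i < n, ¬(g i ∈ A ↔ g (i + 1) ∈ A) → g i ∈ C ∨ g (i + 1) ∈ C) :
    (switches g n A).card ≤ 2 * C.card := by
  have h1 : ((range n).filter fun i => g i ∈ C).card ≤ C.card :=
    card_le_card_of_injOn g (fun i hi => (mem_filter.1 hi).2)
      (hg.mono fun i hi => (mem_filter.1 hi).1)
  have h2 : ((range n).filter fun i => g (i + 1) ∈ C).card ≤ C.card :=
    card_le_card_of_injOn (fun i => g (i + 1)) (fun i hi => (mem_filter.1 hi).2)
      (hg'.mono fun i hi => (mem_filter.1 hi).1)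
  have h3 : switches g n A ⊆
      ((range n).filter fun i => g i ∈ C) ∪ ((range n).filter fun i => g (i + 1) ∈ C) := by
    intro i hi
    obtain ⟨hi, hi'⟩ := mem_filter.1 hi
    rw [mem_union, mem_filter, mem_filter]
    exact (h i (mem_range.1 hi) hi').imp (⟨hi, ·⟩) (⟨hi, ·⟩)
  have := (card_le_card h3).trans (card_union_le _ _)
  omega

variable [Fintype V] {G : SimpleGraph V} {f : V → V} {g : ℕ → V}

/-- If every set that is closed under the matching `f` and has few switches along the cycle `g` is
very small or very large, then few deleted vertices leave a giant component. -/
theorem exists_inGiant (hf : Function.Involutive f) (hfG : ∀ x, G.Adj x (f x))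
    (hgG : ∀ i < Fintype.card V, G.Adj (g i) (g (i + 1)))
    (hg : Set.InjOn g (range (Fintype.card V)))
    (hg' : Set.InjOn (fun i => g (i + 1)) (range (Fintype.card V)))
    (hA : ∀ A : Finset V, (∀ x ∈ A, f x ∈ A) →
      500 * (switches g (Fintype.card V) A).card ≤ Fintype.card V →
      6 * A.card < Fintype.card V ∨ 5 * Fintype.card V < 6 * A.card)
    (hn : 10 ≤ Fintype.card V) {C : Finset V} (hC : 1000 * C.card ≤ Fintype.card V) :
    ∃ w, InGiant G C w := by
  have dichotomy : ∀ S : Finset V, (∀ x ∈ S, ∀ y, G.Adj x y → y ∈ S ∨ y ∈ C) →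
      6 * S.card < Fintype.card V ∨ 5 * Fintype.card V < 6 * (S.card + C.card) := by
    intro S hS
    -- Closing `S` under the matching adds only vertices of `C`, so it hardly changes the size.
    have hsub : S ∪ S.image f ⊆ S ∪ C := by
      intro y hy
      rw [mem_union, mem_image] at hy
      rw [mem_union]
      rcases hy with hy | ⟨x, hx, rfl⟩
      · exact Or.inl hy
      · exact hS x hx _ (hfG x)
    have key : ∀ x y, G.Adj x y → x ∈ S ∪ S.image f → y ∉ S ∪ S.image f → x ∈ C ∨ y ∈ C := by
      intro x y hxy hx hy
      rcases mem_union.1 (hsub hx) with h | h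
      · exact Or.inr ((hS x h y hxy).resolve_left fun h => hy (mem_union_left _ h))
      · exact Or.inl h
    have hcard : (S ∪ S.image f).card ≤ S.card + C.card :=
      (card_le_card hsub).trans (card_union_le _ _)
    have hle : S.card ≤ (S ∪ S.image f).card := card_le_card subset_union_left
    have hsw : (switches g (Fintype.card V) (S ∪ S.image f)).card ≤ 2 * C.card := by
      refine card_switches_le hg hg' fun i hi h => ?_
      by_cases h1 : g i ∈ S ∪ S.image f
      · exact key _ _ (hgG i hi) h1 fun h2 => h ⟨fun _ => h2, fun _ => h1⟩
      · exact (key _ _ (hgG i hi).symm (by_contra fun h2 => h ⟨fun h => absurd h h1,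
          fun h => absurd h h2⟩) h1).symm
    have hclosed : ∀ x ∈ S ∪ S.image f, f x ∈ S ∪ S.image f := by
      intro x hx
      rw [mem_union, mem_image] at hx ⊢
      rcases hx with hx | ⟨y, hy, rfl⟩
      · exact Or.inr ⟨x, hx, rfl⟩
      · exact Or.inl (by rwa [hf y])
    rcases hA _ hclosed (by omega) with h | h <;> omega
  have hcluster : ∀ w, w ∉ C → ∀ x ∈ cluster G C w, ∀ y, G.Adj x y → y ∈ cluster G C w ∨ y ∈ C := by
    intro w hw x hx y hxy
    by_cases hy : y ∈ C
    · exact Or.inr hy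
    · rw [mem_cluster] at hx
      exact Or.inl (mem_cluster.2 (hx.tail ⟨hxy, hx.notMem hw, hy⟩))
  classical
  -- Take a largest small set whose boundary lies in `C`. If the component of a vertex `w` outside
  -- `S ∪ C` were small, its union with `S` would have fewer than `n/3` vertices, hence be small by
  -- the dichotomy, against maximality.
  obtain ⟨S, hS, hmax⟩ := exists_max_image
    (univ.filter fun S : Finset V => (∀ x ∈ S, ∀ y, G.Adj x y → y ∈ S ∨ y ∈ C) ∧
      6 * S.card < Fintype.card V) card ⟨∅, by simp; omega⟩
  rw [mem_filter] at hS
  obtain ⟨w, hw⟩ : ∃ w, w ∉ S ∪ C := by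
    by_contra! h
    have h1 : (S ∪ C).card = Fintype.card V := by rw [eq_univ_iff_forall.2 h, card_univ]
    have h2 := card_union_le S C
    omega
  rw [mem_union, not_or] at hw
  refine ⟨w, hw.2, ?_⟩
  rcases dichotomy _ (hcluster w hw.2) with h | h
  · exfalso
    have hunion : ∀ x ∈ S ∪ cluster G C w, ∀ y, G.Adj x y → y ∈ S ∪ cluster G C w ∨ y ∈ C := by
      intro x hx y hxy
      rw [mem_union] at hx ⊢
      rcases hx with hx | hx
      · exact (hS.2.1 x hx y hxy).imp_left Or.inl
      · exact (hcluster w hw.2 x hx y hxy).imp_left Or.inr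
    have h1 := card_union_le S (cluster G C w)
    have h2 : S.card < (S ∪ cluster G C w).card :=
      card_lt_card ⟨subset_union_left, fun h => hw.1 (h (mem_union_right _
        (mem_cluster.2 Relation.ReflTransGen.refl)))⟩
    have h3 : 6 * (S ∪ cluster G C w).card < Fintype.card V := by
      rcases dichotomy _ hunion with h | h <;> omega
    have := hmax _ (mem_filter.2 ⟨mem_univ _, hunion, h3⟩)
    omega
  · omega

end Separators

/-! ### Union bound over separators. -/

section Counting

variable {V : Type*} [Fintype V] [DecidableEq V]

/-- The fixed-point-free involutions, which encode the perfect matchings. -/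
def pairings (V : Type*) [Fintype V] [DecidableEq V] : Finset (V → V) :=
  univ.filter fun f => (∀ x, f (f x) = x) ∧ ∀ x, f x ≠ x

/-- The pairings that preserve the set `A`. -/
def pairingsPreserving (A : Finset V) : Finset (V → V) :=
  (pairings V).filter fun f => ∀ x ∈ A, f x ∈ A

theorem mem_pairings {f : V → V} : f ∈ pairings V ↔ (∀ x, f (f x) = x) ∧ ∀ x, f x ≠ x := by
  simp [pairings]

theorem card_eq_two_mul_card_filter_lt [LinearOrder V] {f : V → V} (hf : f ∈ pairings V)
    {A : Finset V} (hA : ∀ x ∈ A, f x ∈ A) : A.card = 2 * (A.filter fun x => x < f x).card := by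
  rw [mem_pairings] at hf
  have h1 := card_filter_add_card_filter_not (s := A) (fun x => x < f x)
  have h2 : (A.filter fun x => ¬x < f x).card = (A.filter fun x => x < f x).card := by
    refine card_bij' (fun x _ => f x) (fun x _ => f x) ?_ ?_ ?_ ?_
    · intro x hx
      obtain ⟨hx, hx'⟩ := mem_filter.1 hx
      rw [mem_filter, hf.1]
      exact ⟨hA x hx, lt_of_le_of_ne (not_lt.1 hx') (hf.2 x)⟩
    · intro x hx
      obtain ⟨hx, hx'⟩ := mem_filter.1 hx
      rw [mem_filter, hf.1]
      exact ⟨hA x hx, hx'.asymm⟩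
    · exact fun x _ => hf.1 x
    · exact fun x _ => hf.1 x
  omega

/-- A closed set is a union of pairs, hence determined by the smaller elements of its pairs. -/
theorem card_preserved_le [LinearOrder V] {f : V → V} (hf : f ∈ pairings V) {m : ℕ}
    (hm : Fintype.card V = 2 * m) (j : ℕ) :
    ((powersetCard (2 * j) univ).filter fun A : Finset V => ∀ x ∈ A, f x ∈ A).card
      ≤ m.choose j := by
  have hX : (univ.filter fun x => x < f x).card = m := by
    have := card_eq_two_mul_card_filter_lt hf (A := univ) (by simp)
    rw [card_univ] at this
    omega
  rw [← hX, ← card_powersetCard]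
  refine card_le_card_of_injOn (fun A => A.filter fun x => x < f x) ?_ ?_
  · intro A hA
    obtain ⟨hA, hA'⟩ := mem_filter.1 hA
    have h1 := card_eq_two_mul_card_filter_lt hf hA'
    have h2 := (mem_powersetCard.1 hA).2
    exact mem_powersetCard.2 ⟨filter_subset_filter _ (subset_univ _), by
      change (A.filter fun x => x < f x).card = j
      omega⟩
  · have key : ∀ A B : Finset V, (∀ x ∈ A, f x ∈ A) → (∀ x ∈ B, f x ∈ B) →
        (A.filter fun x => x < f x) = (B.filter fun x => x < f x) → A ⊆ B := by
      intro A B hA hB h x hx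
      have hf := mem_pairings.1 hf
      rcases lt_or_gt_of_ne (hf.2 x) with hlt | hlt
      · have : f x ∈ B.filter fun x => x < f x := by
          rw [← h, mem_filter, hf.1]
          exact ⟨hA x hx, hlt⟩
        have := hB _ (mem_filter.1 this).1
        rwa [hf.1] at this
      · have : x ∈ B.filter fun x => x < f x := by
          rw [← h, mem_filter]
          exact ⟨hx, hlt⟩
        exact (mem_filter.1 this).1
    intro A hA B hB h
    have hA := (mem_filter.1 hA).2
    have hB := (mem_filter.1 hB).2
    exact (key A B hA hB h).antisymm (key B A hB hA h.symm)

/-- Conjugate by a permutation carrying `A` to `B`. -/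
theorem card_pairingsPreserving_le_of_card_eq {A B : Finset V} (h : A.card = B.card) :
    (pairingsPreserving A).card ≤ (pairingsPreserving B).card := by
  let e : {x // x ∈ A} ≃ {x // x ∈ B} := equivOfCardEq h
  let π : Equiv.Perm V := e.extendSubtype
  have h1 : ∀ x, π x ∈ B → x ∈ A := fun x hx =>
    by_contra fun hA => e.extendSubtype_not_mem x hA hx
  have h2 : ∀ x, x ∈ A → π x ∈ B := fun x hx => e.extendSubtype_mem x hx
  refine card_le_card_of_injOn (fun f x => π (f (π.symm x))) ?_ ?_
  · intro f hf
    obtain ⟨hf, hA⟩ := mem_filter.1 hf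
    rw [mem_pairings] at hf
    refine mem_filter.2 ⟨mem_pairings.2 ⟨fun x => ?_, fun x hx => ?_⟩, fun x hx => ?_⟩
    · simp [hf.1]
    · exact hf.2 (π.symm x) (π.injective (by simpa using hx))
    · exact h2 _ (hA _ (h1 _ (by simpa using hx)))
  · intro f _ f' _ hff
    funext x
    have := congrFun hff (π x)
    simpa using this

/-- One term of Vandermonde's sum. -/
theorem choose_sq_le (m j : ℕ) : m.choose j * m.choose j ≤ (2 * m).choose (2 * j) := by
  rw [two_mul m, Nat.add_choose_eq]
  exact single_le_sum (f := fun ij : ℕ × ℕ => m.choose ij.1 * m.choose ij.2) (a := (j, j))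
    (fun _ _ => Nat.zero_le _) (by simp [two_mul])

theorem two_pow_le_choose {m j q : ℕ} (h1 : q ≤ j) (h2 : q + j ≤ m) : 2 ^ q ≤ m.choose j := by
  induction q generalizing m j with
  | zero => exact Nat.choose_pos (by omega)
  | succ q ih =>
    obtain ⟨m, rfl⟩ : ∃ m', m = m' + 1 := ⟨m - 1, by omega⟩
    obtain ⟨j, rfl⟩ : ∃ j', j = j' + 1 := ⟨j - 1, by omega⟩
    rw [Nat.choose_succ_succ', pow_succ]
    have h3 := @ih m j (by omega) (by omega)
    have h4 := @ih m (j + 1) (by omega) (by omega)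
    omega

/-- A set that is neither small nor large is preserved by few pairings. -/
theorem card_pairingsPreserving_mul_le [LinearOrder V] {m : ℕ} (hm : Fintype.card V = 2 * m)
    {A : Finset V} {q : ℕ} (h1 : 2 * q ≤ A.card) (h2 : 2 * q + A.card ≤ 2 * m) :
    (pairingsPreserving A).card * 2 ^ q ≤ (pairings V).card := by
  by_cases hne : ∃ f, f ∈ pairingsPreserving A
  swap
  · have : pairingsPreserving A = ∅ := eq_empty_of_forall_notMem fun f hf => hne ⟨f, hf⟩
    simp [this]
  obtain ⟨f, hf⟩ := hne
  obtain ⟨j, hj⟩ : ∃ j, A.card = 2 * j :=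
    ⟨_, card_eq_two_mul_card_filter_lt (mem_filter.1 hf).1 (mem_filter.1 hf).2⟩
  -- Counting pairs (set of size `2j`, pairing preserving it) in two ways bounds the proportion of
  -- pairings preserving `A` by `m.choose j / (2m).choose (2j)`, hence by `1 / m.choose j`.
  have hdouble := sum_card_bipartiteAbove_eq_sum_card_bipartiteBelow
    (s := powersetCard (2 * j) (univ : Finset V)) (t := pairings V)
    (fun (A : Finset V) (f : V → V) => ∀ x ∈ A, f x ∈ A)
  have hleft : (pairingsPreserving A).card * (2 * m).choose (2 * j) ≤
      ∑ A ∈ powersetCard (2 * j) (univ : Finset V), (pairingsPreserving A).card := by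
    rw [← hm, ← card_univ, ← card_powersetCard, mul_comm, ← smul_eq_mul]
    exact card_nsmul_le_sum _ _ _ fun B hB => card_pairingsPreserving_le_of_card_eq
      (hj.trans (mem_powersetCard.1 hB).2.symm)
  have hright : ∑ f ∈ pairings V, ((powersetCard (2 * j) univ).filter
      fun A : Finset V => ∀ x ∈ A, f x ∈ A).card ≤ (pairings V).card * m.choose j := by
    rw [← smul_eq_mul]
    exact sum_le_card_nsmul _ _ _ fun f hf => card_preserved_le hf hm j
  have htot := hleft.trans (hdouble.le.trans hright)
  have hpos : 0 < m.choose j := Nat.choose_pos (by omega)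
  have hsq := Nat.mul_le_mul_left (pairingsPreserving A).card (choose_sq_le m j)
  rw [← mul_assoc] at hsq
  have := Nat.le_of_mul_le_mul_right (hsq.trans htot) hpos
  exact (Nat.mul_le_mul_left _ (two_pow_le_choose (by omega) (by omega))).trans this

/-- A Chernoff-type bound: give `D` the weight `64 ^ (n - |D|)`; the total is `65 ^ n`. -/
theorem card_powerset_filter_card_le_mul (n d : ℕ) :
    ((range n).powerset.filter fun D => D.card ≤ d).card * 64 ^ n ≤ 65 ^ n * 64 ^ d := by
  have h := sum_pow_mul_eq_add_pow 1 64 (range n)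
  rw [card_range] at h
  calc ((range n).powerset.filter fun D => D.card ≤ d).card * 64 ^ n
      = ∑ D ∈ (range n).powerset.filter fun D => D.card ≤ d, 64 ^ n := by simp
    _ ≤ ∑ D ∈ (range n).powerset.filter fun D => D.card ≤ d,
          1 ^ D.card * 64 ^ (n - D.card) * 64 ^ d := by
        refine sum_le_sum fun D hD => ?_
        rw [one_pow, one_mul, ← pow_add]
        have := (mem_filter.1 hD).2
        exact Nat.pow_le_pow_right (by norm_num) (by omega)
    _ ≤ ∑ D ∈ (range n).powerset, 1 ^ D.card * 64 ^ (n - D.card) * 64 ^ d :=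
        sum_le_sum_of_subset (filter_subset _ _)
    _ = 65 ^ n * 64 ^ d := by rw [← sum_mul, h]

/-- A set is determined by its switches along an enumeration of all vertices and by whether it
contains the first vertex. -/
theorem card_filter_card_switches_le {g : ℕ → V} {n : ℕ} (hg : ∀ x, ∃ i ≤ n, g i = x) (d : ℕ) :
    (univ.filter fun A : Finset V => (switches g n A).card ≤ d).card ≤
      2 * ((range n).powerset.filter fun D => D.card ≤ d).card := by
  have h2 : 2 = (univ : Finset Bool).card := rfl
  rw [h2, ← card_product]
  refine card_le_card_of_injOn (fun A => (decide (g 0 ∈ A), switches g n A)) ?_ ?_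
  · intro A hA
    refine mem_product.2 ⟨mem_univ _, mem_filter.2 ⟨?_, (mem_filter.1 hA).2⟩⟩
    exact mem_powerset.2 (filter_subset _ _)
  · intro A _ B _ h
    rw [Prod.mk.injEq, decide_eq_decide] at h
    have key : ∀ i ≤ n, g i ∈ A ↔ g i ∈ B := by
      intro i
      induction i with
      | zero => exact fun _ => h.1
      | succ i ih =>
        intro hi
        have h3 := Finset.ext_iff.1 h.2 i
        simp only [switches, mem_filter, mem_range] at h3
        have h4 := ih (by omega)
        have h5 : i < n := by omega
        tauto
    ext x
    obtain ⟨i, hi, rfl⟩ := hg x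
    exact key i hi

/-- This rests on `(65/64) ^ 32 ≤ 2`, after rounding `n` up to a multiple of 32. -/
theorem sixty_five_pow_le (n : ℕ) : 65 ^ n ≤ 2 ^ (n / 32 + 1) * 64 ^ n := by
  have h1 : 65 ^ n * 64 ^ (32 * (n / 32 + 1) - n) ≤ 65 ^ (32 * (n / 32 + 1)) := by
    calc 65 ^ n * 64 ^ (32 * (n / 32 + 1) - n)
        ≤ 65 ^ n * 65 ^ (32 * (n / 32 + 1) - n) :=
          Nat.mul_le_mul_left _ (Nat.pow_le_pow_left (by norm_num) _)
      _ = 65 ^ (32 * (n / 32 + 1)) := by rw [← pow_add]; congr 1; omega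
  have h2 : 65 ^ (32 * (n / 32 + 1)) ≤ 2 ^ (n / 32 + 1) * 64 ^ (32 * (n / 32 + 1)) := by
    rw [pow_mul, pow_mul 64, ← mul_pow]
    exact Nat.pow_le_pow_left (by norm_num) _
  have h3 : 64 ^ (32 * (n / 32 + 1)) = 64 ^ n * 64 ^ (32 * (n / 32 + 1) - n) := by
    rw [← pow_add]; congr 1; omega
  rw [h3, ← mul_assoc] at h2
  exact Nat.le_of_mul_le_mul_right (h1.trans h2) (by positivity)

/-- The sets that would separate the union of a cycle and a matching into two large parts. -/
def separators (g : ℕ → V) : Finset (Finset V) :=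
  univ.filter fun A => 500 * (switches g (Fintype.card V) A).card ≤ Fintype.card V ∧
    Fintype.card V ≤ 6 * A.card ∧ 6 * A.card ≤ 5 * Fintype.card V

/-- The pairings that preserve some separator of the cycle `g`. -/
def badPairings (g : ℕ → V) : Finset (V → V) :=
  (separators g).biUnion pairingsPreserving

theorem card_badPairings_mul_le [LinearOrder V] {g : ℕ → V} (hV : Even (Fintype.card V))
    (hg : ∀ x, ∃ i ≤ Fintype.card V, g i = x) :
    (badPairings g).card * 2 ^ (Fintype.card V / 30) ≤ 8 * (pairings V).card := by
  obtain ⟨m, hm⟩ := hV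
  set n := Fintype.card V with hn
  have h1 : (badPairings g).card * 2 ^ (n / 12) ≤ (separators g).card * (pairings V).card := by
    calc (badPairings g).card * 2 ^ (n / 12)
        ≤ (∑ A ∈ separators g, (pairingsPreserving A).card) * 2 ^ (n / 12) :=
          Nat.mul_le_mul_right _ card_biUnion_le
      _ = ∑ A ∈ separators g, (pairingsPreserving A).card * 2 ^ (n / 12) := sum_mul _ _ _
      _ ≤ (separators g).card • (pairings V).card := by
          refine sum_le_card_nsmul _ _ _ fun A hA => ?_
          have := (mem_filter.1 hA).2
          exact card_pairingsPreserving_mul_le (m := m) (by omega) (by omega) (by omega)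
      _ = _ := smul_eq_mul _ _
  have h2 : (separators g).card ≤ 2 * 2 ^ (n / 32 + 1 + 6 * (n / 500)) := by
    have h3 : separators g ⊆ univ.filter fun A : Finset V => (switches g n A).card ≤ n / 500 := by
      intro A hA
      have := (mem_filter.1 hA).2
      rw [← hn] at this
      exact mem_filter.2 ⟨mem_univ _, by omega⟩
    have h4 := (card_le_card h3).trans (card_filter_card_switches_le hg _)
    have h5 := card_powerset_filter_card_le_mul n (n / 500)
    have h6 := h5.trans (Nat.mul_le_mul_right _ (sixty_five_pow_le n))
    have h7 : 2 ^ (n / 32 + 1) * 64 ^ n * 64 ^ (n / 500) =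
        2 ^ (n / 32 + 1 + 6 * (n / 500)) * 64 ^ n := by
      rw [pow_add _ _ (6 * (n / 500)), pow_mul]
      norm_num
      ring
    rw [h7] at h6
    have h8 := Nat.le_of_mul_le_mul_right h6 (by positivity)
    omega
  -- The constants fit because `1/30 + 1/32 + 6/500 < 1/12`; one extra factor 2 absorbs the rounding
  -- of `n / 12`.
  have h9 : (badPairings g).card * 2 ^ (n / 30) * 2 ^ (n / 32 + 6 * (n / 500)) ≤
      8 * (pairings V).card * 2 ^ (n / 32 + 6 * (n / 500)) := by
    calc (badPairings g).card * 2 ^ (n / 30) * 2 ^ (n / 32 + 6 * (n / 500))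
        = (badPairings g).card * 2 ^ (n / 30 + (n / 32 + 6 * (n / 500))) := by
          rw [mul_assoc, ← pow_add]
      _ ≤ (badPairings g).card * 2 ^ (n / 12 + 1) :=
          Nat.mul_le_mul_left _ (Nat.pow_le_pow_right (by norm_num) (by omega))
      _ = (badPairings g).card * 2 ^ (n / 12) * 2 := by rw [pow_succ, mul_assoc]
      _ ≤ (separators g).card * (pairings V).card * 2 := Nat.mul_le_mul_right _ h1
      _ ≤ 2 * 2 ^ (n / 32 + 1 + 6 * (n / 500)) * (pairings V).card * 2 := by gcongr
      _ = 8 * (pairings V).card * 2 ^ (n / 32 + 6 * (n / 500)) := by ring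
  exact Nat.le_of_mul_le_mul_right h9 (by positivity)

end Counting

/-! ### Transfer from involutions to random perfect matchings. -/

section Matchings

variable {V : Type*} [Fintype V] [DecidableEq V]

/-- The subgraph with an edge between `x` and `f x` whenever `f` swaps these two vertices. -/
def toMatching (f : V → V) : (⊤ : SimpleGraph V).Subgraph where
  verts := Set.univ
  Adj x y := x ≠ y ∧ f x = y ∧ f y = x
  adj_sub h := h.1
  edge_vert _ := Set.mem_univ _
  symm := ⟨fun _ _ h => ⟨h.1.symm, h.2.2, h.2.1⟩⟩

theorem toMatching_adj {f : V → V} (hf : f ∈ pairings V) {x y : V} :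
    (toMatching f).Adj x y ↔ f x = y := by
  rw [mem_pairings] at hf
  refine ⟨fun h => h.2.1, ?_⟩
  rintro rfl
  exact ⟨(hf.2 x).symm, rfl, hf.1 x⟩

theorem toMatching_injOn : Set.InjOn (toMatching (V := V)) (pairings V) := by
  intro f hf f' hf' h
  funext x
  have := (toMatching_adj hf (x := x)).2 rfl
  rw [h, toMatching_adj hf'] at this
  exact this.symm

theorem perfectMatchings_eq_image :
    perfectMatchings V = toMatching '' (pairings V : Set (V → V)) := by
  ext M
  constructor
  · intro hM
    have hM' := SimpleGraph.Subgraph.isPerfectMatching_iff.1 hM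
    choose f hf hf' using hM'
    have hinv : ∀ x, f (f x) = x := fun x => (hf' _ _ (hf x).symm).symm
    have hmem : f ∈ pairings V := mem_pairings.2 ⟨hinv, fun x => (hf x).ne.symm⟩
    refine ⟨f, hmem, SimpleGraph.Subgraph.ext ?_ ?_⟩
    · exact (SimpleGraph.Subgraph.isSpanning_iff.1 hM.2).symm
    · funext x y
      rw [toMatching_adj hmem]
      exact propext ⟨fun h => h ▸ hf x, fun h => (hf' x y h).symm⟩
  · rintro ⟨f, hf, rfl⟩
    refine SimpleGraph.Subgraph.isPerfectMatching_iff.2 fun x => ⟨f x, ?_, fun y hy => ?_⟩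
    · exact (toMatching_adj hf).2 rfl
    · exact ((toMatching_adj hf).1 hy).symm

/-- An event that holds outside a small set of pairings has high probability. -/
theorem le_real_randomPerfectMatching (hne : (pairings V).Nonempty) {B : Finset (V → V)}
    {E : Set (⊤ : SimpleGraph V).Subgraph} (hE : ∀ f ∈ pairings V, f ∉ B → toMatching f ∈ E)
    {ε : ℝ} (hB : (B.card : ℝ) ≤ ε * (pairings V).card) :
    1 - ε ≤ (randomPerfectMatching V).real E := by
  classical
  have hPM : perfectMatchings V = ((pairings V).image toMatching : Set _) := by
    rw [perfectMatchings_eq_image, coe_image]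
  have : MeasurableSingletonClass (⊤ : SimpleGraph V).Subgraph := ⟨fun _ => trivial⟩
  have hprob : MeasureTheory.IsProbabilityMeasure (randomPerfectMatching V) := by
    rw [randomPerfectMatching, hPM]
    exact ProbabilityTheory.isProbabilityMeasure_uniformOn (finite_toSet _)
      (coe_nonempty.2 (hne.image _))
  have hpos : (0 : ℝ) < (pairings V).card := by exact_mod_cast hne.card_pos
  have hsub : (((pairings V) \ B).image toMatching : Set _) ⊆ E := by
    intro M hM
    rw [coe_image] at hM
    obtain ⟨f, hf, rfl⟩ := hM
    have hf := mem_sdiff.1 (mem_coe.1 hf)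
    exact hE f hf.1 hf.2
  refine le_trans ?_ (MeasureTheory.measureReal_mono hsub)
  have hval : (randomPerfectMatching V).real (((pairings V) \ B).image toMatching : Set _) =
      ((pairings V) \ B).card / (pairings V).card := by
    rw [MeasureTheory.measureReal_def, randomPerfectMatching, hPM,
      ProbabilityTheory.uniformOn_apply_finset,
      inter_eq_right.2 (image_subset_image sdiff_subset), card_image_of_injOn toMatching_injOn,
      card_image_of_injOn (toMatching_injOn.mono (by simp)), ENNReal.toReal_div]
    simp
  rw [hval, le_div_iff₀ hpos]
  have : (pairings V).card ≤ ((pairings V) \ B).card + B.card := by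
    have := le_card_sdiff B (pairings V)
    omega
  have : ((pairings V).card : ℝ) ≤ ((pairings V) \ B).card + B.card := by exact_mod_cast this
  linarith

theorem pairings_fin_nonempty {n : ℕ} (hn : Even n) : (pairings (Fin n)).Nonempty := by
  refine ⟨Fin.rev, mem_pairings.2 ⟨Fin.rev_rev, fun x hx => ?_⟩⟩
  have h1 := congrArg Fin.val hx
  rw [Fin.val_rev] at h1
  have h2 := x.isLt
  obtain ⟨m, rfl⟩ := hn
  omega

/-- Unless the matching preserves a separator of the Hamiltonian cycle, few cops do not suffice on
the union. -/
theorem not_copsSuffice_of_notMem_badPairings {a : V} {c : (⊤ : SimpleGraph V).Walk a a}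
    (hc : c.IsHamiltonianCycle) (hn : 10 ≤ Fintype.card V) {f : V → V} (hf : f ∈ pairings V)
    (hbad : f ∉ badPairings c.getVert) {k : ℕ} (hk : 1000 * k ≤ Fintype.card V) :
    ¬ CopsSuffice (cycleUnionMatching c (toMatching f)) k := by
  have hlen := hc.length_eq
  refine not_copsSuffice_of_giant fun C hC => exists_inGiant (f := f) (g := c.getVert)
    (mem_pairings.1 hf).1 (fun x => ?_) (fun i hi => ?_) ?_ ?_ ?_ hn (by omega)
  · exact Or.inr ((toMatching_adj hf).2 rfl)
  · exact Or.inl (c.toSubgraph_adj_getVert (by omega))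
  · refine hc.isCycle.getVert_injOn'.mono fun i hi => ?_
    have := mem_range.1 (mem_coe.1 hi)
    change i ≤ c.length - 1
    omega
  · intro i hi j hj hij
    have h1 := mem_range.1 (mem_coe.1 hi)
    have h2 := mem_range.1 (mem_coe.1 hj)
    have := hc.isCycle.getVert_injOn (x₁ := i + 1) (x₂ := j + 1)
      ⟨by omega, by omega⟩ ⟨by omega, by omega⟩ hij
    omega
  · intro A hA hsw
    by_contra! h
    exact hbad (mem_biUnion.2 ⟨A, mem_filter.2 ⟨mem_univ _, hsw, h.1, h.2⟩,
      mem_filter.2 ⟨hf, hA⟩⟩)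

end Matchings

end Entanglement

/-- Let `H` be a Hamiltonian cycle on `n` vertices (`n` even), given by the closed walk `c`, and `M`
a uniformly random perfect matching. For some constant `α > 0`, with probability tending to `1` as
`n → ∞`, uniformly in `H`, at most `α n` cops do not suffice on `H ∪ M`. -/
theorem mainTheorem6 :
    ∃ α : ℝ, 0 < α ∧
      ∀ ε : ℝ, 0 < ε → ∃ N : ℕ, ∀ n : ℕ, N ≤ n → Even n →
        ∀ (a : Fin n) (c : (⊤ : SimpleGraph (Fin n)).Walk a a), c.IsHamiltonianCycle →
          1 - ε ≤ (Entanglement.randomPerfectMatching (Fin n)).real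
            {M | ∀ k : ℕ, (k : ℝ) ≤ α * n →
              ¬ Entanglement.CopsSuffice (Entanglement.cycleUnionMatching c M) k} := by
  refine ⟨1 / 1000, by norm_num, fun ε hε => ?_⟩
  -- The failure probability is at most `8 / 2 ^ (n / 30)`, so `n ≥ 30 * K` brings it below `ε`.
  obtain ⟨K, hK⟩ := pow_unbounded_of_one_lt (8 / ε) (one_lt_two : (1 : ℝ) < 2)
  refine ⟨30 * K + 10, fun n hn heven a c hc => ?_⟩
  have hcard : Fintype.card (Fin n) = n := Fintype.card_fin n
  refine Entanglement.le_real_randomPerfectMatching (Entanglement.pairings_fin_nonempty heven)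
    (B := Entanglement.badPairings c.getVert) (fun f hf hbad => ?_) ?_
  · intro k hk
    refine Entanglement.not_copsSuffice_of_notMem_badPairings hc (by omega) hf hbad ?_
    rw [hcard]
    have : (1000 * k : ℝ) ≤ n := by linarith
    exact_mod_cast this
  · have h1 := Entanglement.card_badPairings_mul_le (g := c.getVert) (by rwa [hcard]) fun x => by
      obtain ⟨i, hi, hi'⟩ := SimpleGraph.Walk.mem_support_iff_exists_getVert.1 (hc.mem_support x)
      exact ⟨i, hi'.trans hc.length_eq.le, hi⟩
    rw [hcard] at h1
    have h2 : (2 : ℝ) ^ K ≤ 2 ^ (n / 30) := pow_le_pow_right₀ one_le_two (by omega)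
    have h3 : 8 ≤ ε * (2 : ℝ) ^ (n / 30) := by
      rw [div_lt_iff₀ hε] at hK
      nlinarith
    have h4 : ((Entanglement.badPairings c.getVert).card : ℝ) * 2 ^ (n / 30) ≤
        8 * (Entanglement.pairings (Fin n)).card := by exact_mod_cast h1
    have h5 : (0 : ℝ) ≤ (Entanglement.pairings (Fin n)).card := Nat.cast_nonneg _
    refine le_of_mul_le_mul_right (a := (2 : ℝ) ^ (n / 30)) ?_ (by positivity)
    calc _ ≤ _ := h4
      _ ≤ (ε * (2 : ℝ) ^ (n / 30)) * (Entanglement.pairings (Fin n)).card :=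
        mul_le_mul_of_nonneg_right h3 h5
      _ = _ := by ring
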